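/- Let $\alpha>-1$ be real and $n\ge 0$ an integer. For $t\in\mathbb{R}$ let $w(x,t)=(1-x^2)^{\alpha}e^{-tx^2}$ on $[-1,1]$, let $\mu_j(t)=\int_{-1}^{1}x^jw(x,t)\,dx$ be its moments and $D_n(t)=\det(\mu_{j+k}(t))_{j,k=0}^{n-1}$ its Hankel determinant ($D_0=1$). Let $P_j(x,t)$ be the monic polynomials of degree $j$ with $\int_{-1}^{1}P_jP_kw\,dx=h_j(t)\delta_{jk}$. Then $D_n$ is positive and differentiable on $\mathbb{R}$. Put $$H_n(t)=n(n+2\alpha)+2t\,\frac{d}{dt}\ln D_n(t).$$ If $\alpha>0$, then for all $t\in\mathbb{R}$ the integrals defining $$R_j(t)=\frac{2\alpha}{h_j(t)}\int_{-1}^{1}\frac{P_j(y,t)^2}{1-y^2}\,w(y,t)\,dy,\qquad 0\le j<n,$$ converge, and $H_n(t)=\sum_{j=0}^{n-1}R_j(t)$. For every $\alpha>-1$, $H_n$ is twice differentiable on $\mathbb{R}$ and, for all $t\in\mathbb{R}$, with $H=H_n(t)$, $H'=H_n'(t)$, $H''=H_n''(t)$, $$\begin{aligned} &\Big\{4t^3(H'')^2+4t^2H''\,[H'-2(t+\alpha)]+8t^2(H')^3-t(H')^2\,[4H+4(t+\alpha)^2-32nt-1]\\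 &\quad-4tH'\,[4(2n+\alpha+t)H+(3t+\alpha)(4nt+4n\alpha+1)]+8(n+\alpha+t)H^2\\ &\quad+4H\,[2t^3+6t^2(n+\alpha)+t(8n\alpha+6\alpha^2+1)+2\alpha^2(n+\alpha)]+8t(t+\alpha)^2[2n(t+\alpha)+1]\Big\}^2\\ &=16\,[H-2tH'+(t+\alpha)^2]\,\Big\{2t^2H''+t(4H+8nt+1)H'-2H^2\\ &\quad-2H[2nt+(t+\alpha)^2]-2t(t+\alpha)[2n(t+\alpha)+1]\Big\}^2 . \end{aligned}$$ The initial values are $$H_n(0)=n(n+2\alpha),\qquad H_n'(0)=-\frac{2n(2n^2+2n\alpha-1)}{(2n-1+2\alpha)(2n+1+2\alpha)},$$ the latter whenever $(2n-1+2\alpha)(2n+1+2\alpha)\neq0$. For $n=1$, moreover, $H_1'(0)=-\dfrac{2}{3+2\alpha}$ for every $\alpha>-1$, including $\alpha=-\tfrac12$, where the quotient above reads $0/0$. -/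

import Mathlib

open Polynomial

noncomputable section

/-- The symmetric semi-classical Jacobi weight `w(x,t) = (1 - x²)^α exp(-t x²)` (used on `[-1,1]`). -/
def jacobiWeight (α t x : ℝ) : ℝ := (1 - x ^ 2) ^ α * Real.exp (-t * x ^ 2)

/-- The moments `μ_j(t) = ∫_{-1}^{1} x^j w(x,t) dx`. -/
def jacobiMoment (α t : ℝ) (j : ℕ) : ℝ := ∫ x in (-1 : ℝ)..1, x ^ j * jacobiWeight α t x

/-- The Hankel determinant `D_n(t) = det (μ_{j+k}(t))_{j,k=0}^{n-1}`. -/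
def hankelD (α : ℝ) (n : ℕ) (t : ℝ) : ℝ :=
  Matrix.det (Matrix.of fun j k : Fin n => jacobiMoment α t ((j : ℕ) + (k : ℕ)))

/-- The inner product `∫_{-1}^{1} p(x) q(x) w(x,t) dx` of two polynomials. -/
def jacobiInner (α t : ℝ) (p q : ℝ[X]) : ℝ :=
  ∫ x in (-1 : ℝ)..1, p.eval x * q.eval x * jacobiWeight α t x

/-- The monic orthogonal polynomials `P_n(·,t)` for the weight, built by Gram–Schmidt from the
monomials; `monicOP_spec` below shows that they are monic of degree `n` and orthogonal, which
determines them uniquely. -/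
def monicOP (α t : ℝ) (n : ℕ) : ℝ[X] :=
  X ^ n - ∑ k : Fin n,
    C (jacobiInner α t (X ^ n) (monicOP α t k) /
        jacobiInner α t (monicOP α t k) (monicOP α t k)) * monicOP α t k
termination_by n
decreasing_by all_goals exact k.isLt

/-- The squared norms `h_n(t) = ∫_{-1}^{1} P_n(x,t)² w(x,t) dx`. -/
def normH (α : ℝ) (n : ℕ) (t : ℝ) : ℝ := jacobiInner α t (monicOP α t n) (monicOP α t n)

/-- The integrand `P_n(y,t)² w(y,t) / (1 - y²)`. -/
def auxRIntegrand (α : ℝ) (n : ℕ) (t y : ℝ) : ℝ :=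
  1 / (1 - y ^ 2) * (monicOP α t n).eval y ^ 2 * jacobiWeight α t y

/-- `R_n(t) = (2α / h_n(t)) ∫_{-1}^{1} P_n(y,t)² w(y,t) / (1 - y²) dy`
(a convergent integral exactly when `α > 0`). -/
def auxR (α : ℝ) (n : ℕ) (t : ℝ) : ℝ :=
  2 * α / normH α n t * ∫ y in (-1 : ℝ)..1, auxRIntegrand α n t y

/-- `H_n(t) = n(n+2α) + 2t (d/dt) ln D_n(t)`. -/
def hankelH (α : ℝ) (n : ℕ) (t : ℝ) : ℝ :=
  n * (n + 2 * α) + 2 * t * deriv (fun s : ℝ => Real.log (hankelD α n s)) t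

end

theorem jacobiWeight_intervalIntegrable {α : ℝ} (hα : -1 < α) (t : ℝ) :
    IntervalIntegrable (jacobiWeight α t) MeasureTheory.volume (-1) 1 := by
  have key : IntervalIntegrable (jacobiWeight α t) MeasureTheory.volume 0 1 := by
    have h0 : IntervalIntegrable (fun x : ℝ => x ^ α) MeasureTheory.volume 1 0 :=
      intervalIntegral.intervalIntegrable_rpow' hα
    have h1 : IntervalIntegrable (fun x : ℝ => (1 - x) ^ α) MeasureTheory.volume 0 1 := by
      have := h0.comp_sub_left 1
      simpa using this
    have h2 : ContinuousOn (fun x : ℝ => (1 + x) ^ α * Real.exp (-t * x ^ 2))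
        (Set.uIcc 0 1) := by
      refine ContinuousOn.mul ?_ (by fun_prop)
      refine ContinuousOn.rpow_const (by fun_prop) ?_
      intro x hx
      rw [Set.uIcc_of_le zero_le_one] at hx
      left
      linarith [hx.1]
    refine (h1.mul_continuousOn h2).congr ?_
    intro x hx
    rw [Set.uIoc_of_le zero_le_one] at hx
    have : (1 : ℝ) - x ^ 2 = (1 - x) * (1 + x) := by ring
    simp only [jacobiWeight]
    rw [this, Real.mul_rpow (by linarith [hx.2]) (by linarith [hx.1]), mul_assoc]
  have key2 : IntervalIntegrable (jacobiWeight α t) MeasureTheory.volume (-1) 0 := by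
    have := key.comp_sub_left 0
    have h3 : (fun x : ℝ => jacobiWeight α t (0 - x)) = jacobiWeight α t := by
      funext x
      simp [jacobiWeight]
    rw [h3] at this
    simpa using this.symm
  exact key2.trans key

theorem jacobiInner_intervalIntegrable {α : ℝ} (hα : -1 < α) (t : ℝ) (p q : ℝ[X]) :
    IntervalIntegrable (fun x => p.eval x * q.eval x * jacobiWeight α t x)
      MeasureTheory.volume (-1) 1 :=
  (jacobiWeight_intervalIntegrable hα t).continuousOn_mul
    ((p.continuous.mul q.continuous).continuousOn)

theorem jacobiInner_comm (α t : ℝ) (p q : ℝ[X]) :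
    jacobiInner α t p q = jacobiInner α t q p := by
  simp only [jacobiInner, mul_comm (p.eval _)]

theorem jacobiInner_add_left {α : ℝ} (hα : -1 < α) (t : ℝ) (p q r : ℝ[X]) :
    jacobiInner α t (p + q) r = jacobiInner α t p r + jacobiInner α t q r := by
  simp only [jacobiInner, eval_add, add_mul]
  exact intervalIntegral.integral_add (jacobiInner_intervalIntegrable hα t p r)
    (jacobiInner_intervalIntegrable hα t q r)

theorem jacobiInner_C_mul_left (α t c : ℝ) (p q : ℝ[X]) :
    jacobiInner α t (C c * p) q = c * jacobiInner α t p q := by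
  simp only [jacobiInner, eval_mul, eval_C, mul_assoc]
  exact intervalIntegral.integral_const_mul _ _

theorem jacobiInner_sum_left {α : ℝ} (hα : -1 < α) (t : ℝ) {ι : Type*} (s : Finset ι)
    (p : ι → ℝ[X]) (q : ℝ[X]) :
    jacobiInner α t (∑ i ∈ s, p i) q = ∑ i ∈ s, jacobiInner α t (p i) q := by
  classical
  induction s using Finset.induction_on with
  | empty => simp [jacobiInner]
  | insert a s ha ih =>
    rw [Finset.sum_insert ha, Finset.sum_insert ha, jacobiInner_add_left hα, ih]

theorem jacobiInner_self_pos {α : ℝ} (hα : -1 < α) (t : ℝ) {p : ℝ[X]} (hp : p ≠ 0) :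
    0 < jacobiInner α t p p := by
  have hw : ∀ x ∈ Set.Ioo (-1 : ℝ) 1, 0 < jacobiWeight α t x := by
    intro x hx
    refine mul_pos (Real.rpow_pos_of_pos ?_ _) (Real.exp_pos _)
    nlinarith [hx.1, hx.2]
  have hint := jacobiInner_intervalIntegrable hα t p p
  rw [jacobiInner, intervalIntegral.integral_of_le (by norm_num),
    MeasureTheory.integral_Ioc_eq_integral_Ioo]
  have hint' : MeasureTheory.IntegrableOn
      (fun x => p.eval x * p.eval x * jacobiWeight α t x) (Set.Ioo (-1) 1) :=
    ((intervalIntegrable_iff_integrableOn_Ioc_of_le (by norm_num)).1 hint).mono_set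
      Set.Ioo_subset_Ioc_self
  rw [MeasureTheory.setIntegral_pos_iff_support_of_nonneg_ae ?_ hint']
  · have hsub : Set.Ioo (-1 : ℝ) 1 \ {x | p.IsRoot x} ⊆
        (Function.support fun x => p.eval x * p.eval x * jacobiWeight α t x) ∩
          Set.Ioo (-1) 1 := by
      rintro x ⟨hx, hr⟩
      refine ⟨?_, hx⟩
      have hr' : p.eval x ≠ 0 := hr
      exact mul_ne_zero (mul_ne_zero hr' hr') (hw x hx).ne'
    refine lt_of_lt_of_le ?_ (MeasureTheory.measure_mono hsub)
    have hfin : ({x | p.IsRoot x} : Set ℝ).Finite := Polynomial.finite_setOfPred_isRoot hp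
    rw [MeasureTheory.measure_sdiff_null (hfin.measure_zero _)]
    simp
  · filter_upwards [MeasureTheory.ae_restrict_mem measurableSet_Ioo] with x hx
    exact mul_nonneg (mul_self_nonneg _) (hw x hx).le

theorem monicOP_degree (α t : ℝ) (n : ℕ) :
    (monicOP α t n).Monic ∧ (monicOP α t n).natDegree = n := by
  induction n using Nat.strong_induction_on with
  | _ n ih =>
    have hdeg : (∑ k : Fin n,
        C (jacobiInner α t (X ^ n) (monicOP α t k) /
          jacobiInner α t (monicOP α t k) (monicOP α t k)) * monicOP α t k).degree < (n : ℕ) := by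
      rw [← Polynomial.mem_degreeLT]
      refine Submodule.sum_mem _ fun k _ => ?_
      rw [← Polynomial.smul_eq_C_mul]
      refine Submodule.smul_mem _ _ ?_
      rw [Polynomial.mem_degreeLT, Polynomial.degree_eq_natDegree (ih k k.isLt).1.ne_zero,
        (ih k k.isLt).2]
      exact_mod_cast k.isLt
    have heq := monicOP.eq_1 α t n
    have hd : (monicOP α t n).degree = n := by
      rw [heq, Polynomial.degree_sub_eq_left_of_degree_lt (by rwa [Polynomial.degree_X_pow]),
        Polynomial.degree_X_pow]
    refine ⟨?_, Polynomial.natDegree_eq_of_degree_eq_some hd⟩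
    rw [heq]
    exact Polynomial.monic_X_pow_sub hdeg

theorem monicOP_orthogonal_lt {α : ℝ} (hα : -1 < α) (t : ℝ) (n : ℕ) :
    ∀ m < n, jacobiInner α t (monicOP α t n) (monicOP α t m) = 0 := by
  induction n using Nat.strong_induction_on with
  | _ n ih =>
    intro m hm
    have hself : jacobiInner α t (monicOP α t m) (monicOP α t m) ≠ 0 :=
      (jacobiInner_self_pos hα t (monicOP_degree α t m).1.ne_zero).ne'
    have hsplit := jacobiInner_add_left hα t (monicOP α t n) (∑ k : Fin n,
        C (jacobiInner α t (X ^ n) (monicOP α t k) /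
          jacobiInner α t (monicOP α t k) (monicOP α t k)) * monicOP α t k) (monicOP α t m)
    have heq : monicOP α t n + (∑ k : Fin n,
        C (jacobiInner α t (X ^ n) (monicOP α t k) /
          jacobiInner α t (monicOP α t k) (monicOP α t k)) * monicOP α t k) = X ^ n := by
      conv_lhs => enter [1]; rw [monicOP.eq_1 α t n]
      exact sub_add_cancel _ _
    rw [heq, jacobiInner_sum_left hα, Finset.sum_eq_single (⟨m, hm⟩ : Fin n)] at hsplit
    · rw [jacobiInner_C_mul_left, div_mul_cancel₀ _ hself] at hsplit
      linarith
    · intro k _ hk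
      have hk' : (k : ℕ) ≠ m := fun h => hk (Fin.ext h)
      have hz : jacobiInner α t (monicOP α t k) (monicOP α t m) = 0 := by
        rcases lt_or_gt_of_ne hk' with h | h
        · rw [jacobiInner_comm, ih m hm k h]
        · exact ih k k.isLt m h
      rw [jacobiInner_C_mul_left, hz, mul_zero]
    · intro h
      exact absurd (Finset.mem_univ _) h

/-- The defining properties of the monic orthogonal polynomials. -/
theorem monicOP_spec {α : ℝ} (hα : -1 < α) (t : ℝ) :
    (∀ n, (monicOP α t n).Monic ∧ (monicOP α t n).natDegree = n ∧ 0 < normH α n t) ∧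
      ∀ m n, ∫ x in (-1 : ℝ)..1,
        (monicOP α t m).eval x * (monicOP α t n).eval x * jacobiWeight α t x =
          if m = n then normH α n t else 0 := by
  refine ⟨fun n => ⟨(monicOP_degree α t n).1, (monicOP_degree α t n).2,
    jacobiInner_self_pos hα t (monicOP_degree α t n).1.ne_zero⟩, fun m n => ?_⟩
  change jacobiInner α t (monicOP α t m) (monicOP α t n) = _
  split_ifs with h
  · subst h
    rfl
  · rcases lt_or_gt_of_ne h with h | h
    · rw [jacobiInner_comm]
      exact monicOP_orthogonal_lt hα t n m h
    · exact monicOP_orthogonal_lt hα t m n h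

/-!
The differential equation comes from the recurrence coefficients `β_n` of the monic orthogonal
polynomials, `x P_n = P_{n+1} + β_n P_{n-1}`. All integrations by parts go through the Pearson
equation `((1 - x²) w)' = (-2(α+1)x - 2tx(1 - x²)) w`, whose boundary terms vanish for every
`α > -1` (`momentFunctional_pearson`). So no analytic continuation from `α > 0` is needed: the
quantities that are usually integrals against `w/(1-x²)` are replaced by their expressions in the
`β_n`, and only for the claim about the `R_j` are those integrals evaluated (`auxR_eq_ladderR`).

Put `S_n = ∑_{j<n} (β_j + β_{j+1})`.

* In `n`, the Pearson equation for `P_n P_{n-1}` gives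
  `S_n = n - 2(n+α+t)β_n + 2tβ_n(β_{n-1} + β_n + β_{n+1})` (`recCoeffSum_eq`). Differences of this
  relation have a first integral, `r_n² + 2αr_n = β_n R_n R_{n-1}` with `r_n = n - 2tβ_n` and
  `R_n = 2n + 1 + 2α - 2t(β_n + β_{n+1})` (`ladder_quadratic`).
* In `t`, the factorisation `D_n = ∏ h_j` and the extremal property of `h_n` give
  `h_n'/h_n = -(β_n + β_{n+1})` (`hasDerivAt_normH`). Hence `(ln D_n)' = -S_n`, and the derivatives
  of `β_n` and `S_n` are polynomials in `β_{n-1}, β_n, β_{n+1}`.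

Therefore `H_n = n(n+2α) - 2tS_n`, `H_n'` and `H_n''` are polynomials in `t`, `β_{n-1}`, `β_n`,
`β_{n+1}`, and these three coefficients satisfy one polynomial relation. Since
`H - 2tH' + (t+α)²` is the square of `n + α + t - 2tβ_n`, the differential equation is an
algebraic consequence (`ode_of_string_equations`). At `t = 0` the two string equations determine
`β_n` and `S_n`, which gives the initial values.
-/

/-! ### The moment functional -/

/-- The linear functional `p ↦ ∫_{-1}^{1} p(x) w(x,t) dx` on polynomials. -/
noncomputable def momentFunctional {α : ℝ} (hα : -1 < α) (t : ℝ) : ℝ[X] →ₗ[ℝ] ℝ where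
  toFun p := jacobiInner α t p 1
  map_add' p q := jacobiInner_add_left hα t p q 1
  map_smul' c p := by rw [smul_eq_C_mul, jacobiInner_C_mul_left]; rfl

theorem momentFunctional_apply {α : ℝ} (hα : -1 < α) (t : ℝ) (p : ℝ[X]) :
    momentFunctional hα t p = ∫ x in (-1 : ℝ)..1, p.eval x * jacobiWeight α t x := by
  simp [momentFunctional, jacobiInner]

theorem momentFunctional_mul {α : ℝ} (hα : -1 < α) (t : ℝ) (p q : ℝ[X]) :
    momentFunctional hα t (p * q) = jacobiInner α t p q := by
  simp [momentFunctional, jacobiInner]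

theorem momentFunctional_C_mul {α : ℝ} (hα : -1 < α) (t c : ℝ) (p : ℝ[X]) :
    momentFunctional hα t (C c * p) = c * momentFunctional hα t p := by
  rw [← smul_eq_C_mul, map_smul, smul_eq_mul]

theorem momentFunctional_comp_neg {α : ℝ} (hα : -1 < α) (t : ℝ) (p : ℝ[X]) :
    momentFunctional hα t (p.comp (-X)) = momentFunctional hα t p := by
  rw [momentFunctional_apply, momentFunctional_apply]
  have := intervalIntegral.integral_comp_neg (a := -1) (b := 1)
    (fun x : ℝ => p.eval x * jacobiWeight α t x)
  rw [neg_neg] at this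
  rw [← this]
  refine intervalIntegral.integral_congr fun x _ => ?_
  simp [jacobiWeight]

/-- Integration by parts against the weight, in the form given by its Pearson equation
`((1 - x²) w)' = (-2(α+1)x - 2tx(1-x²)) w`. The factor `1 - x²` makes the boundary terms vanish
for every `α > -1`. -/
theorem momentFunctional_pearson {α : ℝ} (hα : -1 < α) (t : ℝ) (p : ℝ[X]) :
    momentFunctional hα t ((1 - X ^ 2) * derivative p - C (2 * (α + 1)) * (X * p)
      - C (2 * t) * (X * (1 - X ^ 2) * p)) = 0 := by
  set q : ℝ[X] := (1 - X ^ 2) * derivative p - C (2 * (α + 1)) * (X * p)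
      - C (2 * t) * (X * (1 - X ^ 2) * p) with hq
  have hint : IntervalIntegrable (fun x => q.eval x * jacobiWeight α t x)
      MeasureTheory.volume (-1) 1 := by
    simpa using jacobiInner_intervalIntegrable hα t q 1
  rw [momentFunctional_apply, intervalIntegral.integral_eq_sub_of_hasDerivAt_of_le (by norm_num)
    (f := fun x => (1 - x ^ 2) ^ (α + 1) * Real.exp (-t * x ^ 2) * p.eval x) ?_ ?_ hint]
  · have h0 : (0 : ℝ) ^ (α + 1) = 0 := Real.zero_rpow (by linarith)
    simp [h0]
  · refine ContinuousOn.mul (ContinuousOn.mul ?_ (by fun_prop)) p.continuous.continuousOn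
    exact ContinuousOn.rpow_const (by fun_prop) fun x _ => Or.inr (by linarith)
  · intro x hx
    have hpos : 0 < 1 - x ^ 2 := by nlinarith [hx.1, hx.2]
    have h1 : HasDerivAt (fun x : ℝ => 1 - x ^ 2) (-(2 * x)) x := by
      simpa using (hasDerivAt_pow 2 x).const_sub 1
    have h2 : HasDerivAt (fun x : ℝ => (1 - x ^ 2) ^ (α + 1)) _ x :=
      h1.rpow_const (p := α + 1) (Or.inl hpos.ne')
    have h3 : HasDerivAt (fun x : ℝ => Real.exp (-t * x ^ 2)) _ x :=
      ((hasDerivAt_pow 2 x).const_mul (-t)).exp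
    refine ((h2.mul h3).mul (p.hasDerivAt x)).congr_deriv ?_
    have h4 : (1 - x ^ 2) ^ (α + 1) = (1 - x ^ 2) ^ α * (1 - x ^ 2) := by
      rw [Real.rpow_add hpos, Real.rpow_one]
    simp only [hq, jacobiWeight, eval_sub, eval_mul, eval_pow, eval_X, eval_C, eval_one,
      add_sub_cancel_right, Pi.mul_apply, h4]
    push_cast
    ring

/-- Differentiation in `t` under the integral sign. -/
theorem hasDerivAt_momentFunctional {α : ℝ} (hα : -1 < α) (t : ℝ) (p : ℝ[X]) :
    HasDerivAt (fun s => momentFunctional hα s p) (-momentFunctional hα t (X ^ 2 * p)) t := by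
  have hi : ∀ s, IntervalIntegrable (fun x => p.eval x * jacobiWeight α s x)
      MeasureTheory.volume (-1) 1 := fun s => by
    simpa using jacobiInner_intervalIntegrable hα s p 1
  have hi' : IntervalIntegrable (fun x => -(x ^ 2 * p.eval x * jacobiWeight α t x))
      MeasureTheory.volume (-1) 1 := by
    have := (jacobiInner_intervalIntegrable hα t (X ^ 2) p).neg
    simp only [eval_pow, eval_X] at this
    exact this
  have hval : -momentFunctional hα t (X ^ 2 * p)
      = ∫ x in (-1 : ℝ)..1, -(x ^ 2 * p.eval x * jacobiWeight α t x) := by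
    rw [intervalIntegral.integral_neg, momentFunctional_apply]
    simp
  rw [hval]
  simp only [momentFunctional_apply]
  refine (intervalIntegral.hasDerivAt_integral_of_dominated_loc_of_deriv_le
    (μ := MeasureTheory.volume) (a := -1) (b := 1) (x₀ := t) (s := Metric.ball t 1)
    (F := fun s x => p.eval x * jacobiWeight α s x)
    (F' := fun s x => -(x ^ 2 * p.eval x * jacobiWeight α s x))
    (bound := fun x => |p.eval x * jacobiWeight α 0 x| * Real.exp (|t| + 1))
    (Metric.ball_mem_nhds t one_pos) ?_ (hi t) ?_ ?_ ?_ ?_).2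
  · exact Filter.Eventually.of_forall fun s => (intervalIntegrable_iff.1 (hi s)).aestronglyMeasurable
  · exact (intervalIntegrable_iff.1 hi').aestronglyMeasurable
  · refine Filter.Eventually.of_forall fun x hx s hs => ?_
    rw [Set.uIoc_of_le (by norm_num)] at hx
    rw [Metric.mem_ball, Real.dist_eq] at hs
    have hx2 : x ^ 2 ≤ 1 := by nlinarith [hx.1, hx.2]
    have hs' : |s| ≤ |t| + 1 := by
      have := abs_sub_abs_le_abs_sub s t
      linarith
    have hexp : Real.exp (-s * x ^ 2) ≤ Real.exp (|t| + 1) := by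
      refine Real.exp_le_exp.2 ?_
      nlinarith [neg_abs_le s, abs_nonneg s, sq_nonneg x]
    have hw : -(x ^ 2 * p.eval x * jacobiWeight α s x)
        = -(x ^ 2 * ((p.eval x * jacobiWeight α 0 x) * Real.exp (-s * x ^ 2))) := by
      simp [jacobiWeight]
      ring
    rw [hw, norm_neg, Real.norm_eq_abs, abs_mul, abs_mul, abs_of_nonneg (sq_nonneg x), Real.abs_exp]
    calc x ^ 2 * (|p.eval x * jacobiWeight α 0 x| * Real.exp (-s * x ^ 2))
        ≤ 1 * (|p.eval x * jacobiWeight α 0 x| * Real.exp (|t| + 1)) := by gcongr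
      _ = _ := one_mul _
  · exact (hi 0).abs.mul_const _
  · refine Filter.Eventually.of_forall fun x _ s _ => ?_
    have h3 : HasDerivAt (fun s : ℝ => Real.exp (-s * x ^ 2)) _ s :=
      ((hasDerivAt_id s).neg.mul_const (x ^ 2)).exp
    have h4 := (h3.const_mul ((1 - x ^ 2) ^ α)).const_mul (p.eval x)
    refine h4.congr_deriv ?_
    simp only [jacobiWeight, Pi.neg_apply, id]
    ring

/-! ### Orthogonality and the three-term recurrence -/

theorem monicOP_coeff_of_lt (α t : ℝ) {n m : ℕ} (h : n < m) : (monicOP α t n).coeff m = 0 :=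
  coeff_eq_zero_of_natDegree_lt ((monicOP_degree α t n).2.trans_lt h)

theorem monicOP_coeff_self (α t : ℝ) (n : ℕ) : (monicOP α t n).coeff n = 1 := by
  have h := (monicOP_degree α t n).1.coeff_natDegree
  rwa [(monicOP_degree α t n).2] at h

theorem monicOP_zero (α t : ℝ) : monicOP α t 0 = 1 := by
  rw [monicOP.eq_1]; simp

theorem momentFunctional_monicOP_mul {α : ℝ} (hα : -1 < α) (t : ℝ) (m n : ℕ) :
    momentFunctional hα t (monicOP α t m * monicOP α t n) = if m = n then normH α n t else 0 := by
  rw [momentFunctional_mul]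
  exact (monicOP_spec hα t).2 m n

theorem normH_pos {α : ℝ} (hα : -1 < α) (n : ℕ) (t : ℝ) : 0 < normH α n t :=
  ((monicOP_spec hα t).1 n).2.2

/-- Subtracting the leading coefficient times `P_k` lowers the degree. -/
theorem degree_sub_coeff_mul_monicOP_lt (α t : ℝ) {k : ℕ} {R : ℝ[X]} (hR : R.degree < (k + 1 : ℕ)) :
    (R - C (R.coeff k) * monicOP α t k).degree < k := by
  rw [degree_lt_iff_coeff_zero] at hR ⊢
  intro m hm
  rcases hm.eq_or_lt with rfl | h
  · simp [monicOP_coeff_self]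
  · simp [monicOP_coeff_of_lt α t h, hR m h]

/-- A polynomial orthogonal to `P_0, …, P_{N-1}` is orthogonal to all polynomials of degree
less than `N`. -/
theorem momentFunctional_mul_eq_zero {α : ℝ} (hα : -1 < α) (t : ℝ) {Q : ℝ[X]} {N : ℕ}
    (h : ∀ k < N, momentFunctional hα t (Q * monicOP α t k) = 0) :
    ∀ R : ℝ[X], R.degree < N → momentFunctional hα t (Q * R) = 0 := by
  induction N with
  | zero =>
    intro R hR
    rw [Nat.cast_zero, ← not_le, zero_le_degree_iff, not_not] at hR
    simp [hR]
  | succ k ih =>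
    intro R hR
    have h1 := ih (fun j hj => h j (by omega)) _ (degree_sub_coeff_mul_monicOP_lt α t hR)
    have h2 : Q * R = Q * (R - C (R.coeff k) * monicOP α t k)
        + C (R.coeff k) * (Q * monicOP α t k) := by ring
    rw [h2, map_add, h1, momentFunctional_C_mul, h k k.lt_succ_self, mul_zero, add_zero]

theorem eq_zero_of_momentFunctional_mul_eq_zero {α : ℝ} (hα : -1 < α) (t : ℝ) {Q : ℝ[X]} {N : ℕ}
    (hQ : Q.degree < N) (h : ∀ k < N, momentFunctional hα t (Q * monicOP α t k) = 0) : Q = 0 := by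
  by_contra hne
  have := jacobiInner_self_pos hα t hne
  rw [← momentFunctional_mul hα, momentFunctional_mul_eq_zero hα t h Q hQ] at this
  exact this.false

/-- Against a polynomial of degree at most `n`, the polynomial `P_n` only sees the coefficient
of `x ^ n`. -/
theorem momentFunctional_mul_monicOP {α : ℝ} (hα : -1 < α) (t : ℝ) {Q : ℝ[X]} {n : ℕ}
    (hQ : Q.degree < (n + 1 : ℕ)) :
    momentFunctional hα t (Q * monicOP α t n) = Q.coeff n * normH α n t := by
  have h1 := momentFunctional_mul_eq_zero hα t (Q := monicOP α t n) (N := n)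
    (fun k hk => by rw [momentFunctional_monicOP_mul, if_neg hk.ne']) _
    (degree_sub_coeff_mul_monicOP_lt α t hQ)
  have h2 : Q * monicOP α t n = monicOP α t n * (Q - C (Q.coeff n) * monicOP α t n)
      + C (Q.coeff n) * (monicOP α t n * monicOP α t n) := by ring
  rw [h2, map_add, h1, momentFunctional_C_mul, momentFunctional_monicOP_mul, if_pos rfl, zero_add]

theorem coeff_comp_neg_X (p : ℝ[X]) (n : ℕ) : (p.comp (-X)).coeff n = p.coeff n * (-1) ^ n := by
  have h : (-X : ℝ[X]) = C (-1) * X := by simp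
  rw [h, comp_C_mul_X_coeff]

/-- The weight is even, so `P_n` has the parity of `n`. -/
theorem monicOP_comp_neg {α : ℝ} (hα : -1 < α) (t : ℝ) (n : ℕ) :
    (monicOP α t n).comp (-X) = C ((-1) ^ n) * monicOP α t n := by
  rw [← sub_eq_zero]
  refine eq_zero_of_momentFunctional_mul_eq_zero hα t (N := n) ?_ fun k hk => ?_
  · rw [degree_lt_iff_coeff_zero]
    intro m hm
    rw [coeff_sub, coeff_C_mul, coeff_comp_neg_X]
    rcases hm.eq_or_lt with rfl | h
    · rw [mul_comm, sub_self]
    · simp [monicOP_coeff_of_lt α t h]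
  · have h1 : (monicOP α t n).comp (-X) * monicOP α t k
        = (monicOP α t n * (monicOP α t k).comp (-X)).comp (-X) := by
      rw [mul_comp, comp_assoc]
      simp
    have h2 : momentFunctional hα t (monicOP α t n * (monicOP α t k).comp (-X)) = 0 := by
      refine momentFunctional_mul_eq_zero hα t (N := n)
        (fun j hj => by rw [momentFunctional_monicOP_mul, if_neg hj.ne']) _ ?_
      rw [degree_lt_iff_coeff_zero]
      intro m hm
      rw [coeff_comp_neg_X, monicOP_coeff_of_lt α t (hk.trans_le hm), zero_mul]
    rw [sub_mul, map_sub, h1, momentFunctional_comp_neg, h2, mul_assoc, momentFunctional_C_mul,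
      momentFunctional_monicOP_mul, if_neg hk.ne']
    simp

theorem momentFunctional_X_mul_monicOP_sq {α : ℝ} (hα : -1 < α) (t : ℝ) (n : ℕ) :
    momentFunctional hα t (X * monicOP α t n * monicOP α t n) = 0 := by
  have h := momentFunctional_comp_neg hα t (X * monicOP α t n * monicOP α t n)
  have h2 : (X * monicOP α t n * monicOP α t n).comp (-X)
      = C (-1) * (X * monicOP α t n * monicOP α t n) := by
    rw [mul_comp, mul_comp, monicOP_comp_neg hα, X_comp]
    have : C ((-1 : ℝ) ^ n) * C ((-1) ^ n) = 1 := by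
      rw [← C_mul, ← mul_pow]; simp
    rw [C_neg, C_1]
    linear_combination (-(X * monicOP α t n * monicOP α t n)) * this
  rw [h2, momentFunctional_C_mul] at h
  linarith

/-- The recurrence coefficients `β_n = h_n / h_{n-1}`, with `β_0 = 0`. -/
noncomputable def recCoeff (α : ℝ) : ℕ → ℝ → ℝ
  | 0, _ => 0
  | n + 1, t => normH α (n + 1) t / normH α n t

theorem recCoeff_zero (α t : ℝ) : recCoeff α 0 t = 0 := rfl

theorem normH_succ {α : ℝ} (hα : -1 < α) (n : ℕ) (t : ℝ) :
    normH α (n + 1) t = recCoeff α (n + 1) t * normH α n t := by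
  simp [recCoeff, (normH_pos hα n t).ne']

theorem degree_X_mul_monicOP_lt (α t : ℝ) {n N : ℕ} (h : n + 1 < N) :
    (X * monicOP α t n).degree < (N : WithBot ℕ) := by
  rw [degree_lt_iff_coeff_zero]
  intro m hm
  obtain ⟨m, rfl⟩ : ∃ k, m = k + 1 := ⟨m - 1, by omega⟩
  rw [coeff_X_mul, monicOP_coeff_of_lt α t (by omega)]

/-- The three-term recurrence. At `n = 0` the last term vanishes since `β_0 = 0`. -/
theorem X_mul_monicOP {α : ℝ} (hα : -1 < α) (t : ℝ) (n : ℕ) :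
    X * monicOP α t n = monicOP α t (n + 1) + C (recCoeff α n t) * monicOP α t (n - 1) := by
  rw [← sub_eq_zero]
  refine eq_zero_of_momentFunctional_mul_eq_zero hα t (N := n + 1) ?_ fun k hk => ?_
  · rw [degree_lt_iff_coeff_zero]
    intro m hm
    obtain ⟨m, rfl⟩ : ∃ k, m = k + 1 := ⟨m - 1, by omega⟩
    rw [coeff_sub, coeff_add, coeff_X_mul, coeff_C_mul, monicOP_coeff_of_lt α t (n := n - 1) (by omega)]
    rcases (show n ≤ m by omega).eq_or_lt with rfl | h
    · simp [monicOP_coeff_self]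
    · simp [monicOP_coeff_of_lt α t h, monicOP_coeff_of_lt α t (Nat.succ_lt_succ h)]
  · rw [sub_mul, add_mul, map_sub, map_add, mul_assoc (C _), momentFunctional_C_mul,
      momentFunctional_monicOP_mul, momentFunctional_monicOP_mul, if_neg (by omega : n + 1 ≠ k)]
    rcases (show k ≤ n by omega).eq_or_lt with rfl | h
    · rw [momentFunctional_X_mul_monicOP_sq]
      rcases k with _ | k
      · simp [recCoeff_zero]
      · simp
    · have h1 : X * monicOP α t n * monicOP α t k = X * monicOP α t k * monicOP α t n := by ring
      rw [h1, momentFunctional_mul_monicOP hα t (degree_X_mul_monicOP_lt α t (by omega))]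
      obtain ⟨n, rfl⟩ : ∃ j, n = j + 1 := ⟨n - 1, by omega⟩
      rw [coeff_X_mul, Nat.add_sub_cancel]
      rcases (show k ≤ n by omega).eq_or_lt with rfl | h'
      · simp [monicOP_coeff_self, normH_succ hα]
      · simp [monicOP_coeff_of_lt α t h', h'.ne']

/-! ### The string equations -/

theorem recCoeff_mul_recCoeff_mul_normH_pred {α : ℝ} (hα : -1 < α) (n : ℕ) (t : ℝ) :
    recCoeff α n t * (recCoeff α n t * normH α (n - 1) t) = recCoeff α n t * normH α n t := by
  rcases n with _ | n
  · simp [recCoeff_zero]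
  · rw [normH_succ hα n t, Nat.add_sub_cancel]

theorem momentFunctional_X_mul_monicOP_mul_self {α : ℝ} (hα : -1 < α) (t : ℝ) (n : ℕ) :
    momentFunctional hα t (X * monicOP α t n * (X * monicOP α t n))
      = (recCoeff α n t + recCoeff α (n + 1) t) * normH α n t := by
  have h : X * monicOP α t n * (X * monicOP α t n)
      = monicOP α t (n + 1) * monicOP α t (n + 1)
        + C (recCoeff α n t) * (monicOP α t (n + 1) * monicOP α t (n - 1))
        + C (recCoeff α n t) * (monicOP α t (n + 1) * monicOP α t (n - 1))
        + C (recCoeff α n t) * (C (recCoeff α n t) *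
            (monicOP α t (n - 1) * monicOP α t (n - 1))) := by
    rw [X_mul_monicOP hα]; ring
  rw [h]
  simp only [map_add, momentFunctional_C_mul, momentFunctional_monicOP_mul, if_true,
    if_neg (show n + 1 ≠ n - 1 by omega), normH_succ hα n t,
    recCoeff_mul_recCoeff_mul_normH_pred hα n t]
  ring

theorem momentFunctional_X_mul_monicOP_succ_mul {α : ℝ} (hα : -1 < α) (t : ℝ) (n : ℕ) :
    momentFunctional hα t (X * (monicOP α t (n + 1) * monicOP α t n))
      = recCoeff α (n + 1) t * normH α n t := by
  have h : X * (monicOP α t (n + 1) * monicOP α t n)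
      = X * monicOP α t n * monicOP α t (n + 1) := by ring
  rw [h, momentFunctional_mul_monicOP hα t (degree_X_mul_monicOP_lt α t (by omega)), coeff_X_mul,
    monicOP_coeff_self, one_mul, normH_succ hα]

theorem momentFunctional_X_pow_three_mul {α : ℝ} (hα : -1 < α) (t : ℝ) (n : ℕ) :
    momentFunctional hα t (X ^ 3 * (monicOP α t (n + 1) * monicOP α t n))
      = recCoeff α (n + 1) t * (recCoeff α n t + recCoeff α (n + 1) t + recCoeff α (n + 2) t)
        * normH α n t := by
  have h : X ^ 3 * (monicOP α t (n + 1) * monicOP α t n)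
      = X * monicOP α t (n + 2) * (X * monicOP α t n)
        + C (recCoeff α (n + 1) t) * (X * monicOP α t n * (X * monicOP α t n)) := by
    have h1 := X_mul_monicOP hα t (n + 1)
    rw [Nat.add_sub_cancel] at h1
    linear_combination (X ^ 2 * monicOP α t n) * h1
  have h2 : X * monicOP α t (n + 2) * (X * monicOP α t n)
      = X * (monicOP α t (n + 2) * monicOP α t (n + 1))
        + C (recCoeff α n t) * (X * monicOP α t (n - 1) * monicOP α t (n + 2)) := by
    conv_lhs => rw [X_mul_monicOP hα t n]
    ring
  rw [h, h2]
  simp only [map_add, momentFunctional_C_mul, momentFunctional_X_mul_monicOP_mul_self,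
    momentFunctional_X_mul_monicOP_succ_mul,
    momentFunctional_mul_monicOP hα t (degree_X_mul_monicOP_lt α t (by omega : n - 1 + 1 < n + 2 + 1))]
  rw [coeff_X_mul, monicOP_coeff_of_lt α t (by omega), normH_succ hα n t]
  ring

theorem coeff_X_mul_derivative (p : ℝ[X]) (k : ℕ) :
    (X * derivative p).coeff k = k * p.coeff k := by
  rcases k with _ | k
  · simp
  · rw [coeff_X_mul, coeff_derivative]; push_cast; ring

theorem degree_X_mul_derivative_monicOP_lt (α t : ℝ) (n : ℕ) :
    (X * derivative (monicOP α t n)).degree < ((n + 1 : ℕ) : WithBot ℕ) := by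
  rw [degree_lt_iff_coeff_zero]
  intro m hm
  rw [coeff_X_mul_derivative, monicOP_coeff_of_lt α t (by omega), mul_zero]

theorem momentFunctional_X_mul_derivative_mul {α : ℝ} (hα : -1 < α) (t : ℝ) (n : ℕ) :
    momentFunctional hα t (X * derivative (monicOP α t n) * monicOP α t n)
      = n * normH α n t := by
  rw [momentFunctional_mul_monicOP hα t (degree_X_mul_derivative_monicOP_lt α t n),
    coeff_X_mul_derivative, monicOP_coeff_self, mul_one]

/-- The sum `S_n = ∑_{j<n} (β_j + β_{j+1})`, which is `-(d/dt) ln D_n`. -/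
noncomputable def recCoeffSum (α : ℝ) (n : ℕ) (t : ℝ) : ℝ :=
  ∑ j ∈ Finset.range n, (recCoeff α j t + recCoeff α (j + 1) t)

theorem recCoeffSum_succ (α : ℝ) (n : ℕ) (t : ℝ) :
    recCoeffSum α (n + 1) t = recCoeffSum α n t + (recCoeff α n t + recCoeff α (n + 1) t) :=
  Finset.sum_range_succ _ _

/-- The only integral involving subleading coefficients of the `P_n`; differentiating the
recurrence gives an induction on `n` that avoids naming those coefficients. -/
theorem momentFunctional_X_sq_mul_derivative {α : ℝ} (hα : -1 < α) (t : ℝ) (n : ℕ) :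
    momentFunctional hα t (X * derivative (monicOP α t (n + 1)) * (X * monicOP α t n))
      = (n * recCoeff α (n + 1) t + recCoeffSum α (n + 1) t) * normH α n t := by
  induction n with
  | zero =>
    have h := X_mul_monicOP hα t 0
    simp only [recCoeff_zero, C_0, zero_mul, add_zero, zero_add, monicOP_zero, mul_one] at h
    have h1 := momentFunctional_X_mul_monicOP_mul_self hα t 0
    simp only [monicOP_zero, mul_one, zero_add] at h1
    simp [recCoeffSum, ← h, monicOP_zero, h1]
  | succ n ih =>
    have hrec := X_mul_monicOP hα t (n + 1)
    rw [Nat.add_sub_cancel] at hrec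
    have hder := congrArg derivative hrec
    simp only [derivative_mul, derivative_add, derivative_X, derivative_C, one_mul, zero_mul,
      zero_add] at hder
    have h1 : X * derivative (monicOP α t (n + 2)) * (X * monicOP α t (n + 1))
        = X * derivative (monicOP α t (n + 2)) * monicOP α t (n + 2)
          + C (recCoeff α (n + 1) t) * (X * (monicOP α t (n + 1) * monicOP α t n)
            + X * derivative (monicOP α t (n + 1)) * (X * monicOP α t n)
            - C (recCoeff α (n + 1) t) * (X * derivative (monicOP α t n) * monicOP α t n)) := by
      linear_combination X * derivative (monicOP α t (n + 2)) * hrec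
        - C (recCoeff α (n + 1) t) * X * monicOP α t n * hder
    rw [h1]
    simp only [map_add, map_sub, momentFunctional_C_mul, ih,
      momentFunctional_X_mul_derivative_mul, momentFunctional_X_mul_monicOP_succ_mul,
      recCoeffSum_succ α (n + 1), normH_succ hα]
    push_cast
    ring

/-- The first string equation: the Pearson identity for `P_n P_{n-1}`. It is linear
in `S_n`. For `n = 0` the truncated index `n - 1` is harmless, as `β_0 = 0` multiplies it. -/
theorem recCoeffSum_eq {α : ℝ} (hα : -1 < α) (t : ℝ) (n : ℕ) :
    recCoeffSum α n t = n - 2 * (n + α + t) * recCoeff α n t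
      + 2 * t * recCoeff α n t
        * (recCoeff α (n - 1) t + recCoeff α n t + recCoeff α (n + 1) t) := by
  rcases n with _ | n
  · simp [recCoeffSum, recCoeff_zero]
  have key := momentFunctional_pearson hα t (monicOP α t (n + 1) * monicOP α t n)
  have hexp : (1 - X ^ 2) * derivative (monicOP α t (n + 1) * monicOP α t n)
        - C (2 * (α + 1)) * (X * (monicOP α t (n + 1) * monicOP α t n))
        - C (2 * t) * (X * (1 - X ^ 2) * (monicOP α t (n + 1) * monicOP α t n))
      = derivative (monicOP α t (n + 1)) * monicOP α t n
        + derivative (monicOP α t n) * monicOP α t (n + 1)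
        - X * derivative (monicOP α t (n + 1)) * (X * monicOP α t n)
        - X * (X * derivative (monicOP α t n)) * monicOP α t (n + 1)
        - C (2 * (α + 1)) * (X * (monicOP α t (n + 1) * monicOP α t n))
        - C (2 * t) * (X * (monicOP α t (n + 1) * monicOP α t n))
        + C (2 * t) * (X ^ 3 * (monicOP α t (n + 1) * monicOP α t n)) := by
    rw [derivative_mul]; ring
  have h1 : momentFunctional hα t (derivative (monicOP α t (n + 1)) * monicOP α t n)
      = (n + 1) * normH α n t := by
    rw [momentFunctional_mul_monicOP hα t, coeff_derivative, monicOP_coeff_self, one_mul]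
    rw [degree_lt_iff_coeff_zero]
    intro m hm
    rw [coeff_derivative, monicOP_coeff_of_lt α t (by omega), zero_mul]
  have h2 : momentFunctional hα t (derivative (monicOP α t n) * monicOP α t (n + 1)) = 0 := by
    rw [momentFunctional_mul_monicOP hα t, coeff_derivative, monicOP_coeff_of_lt α t (by omega),
      zero_mul, zero_mul]
    rw [degree_lt_iff_coeff_zero]
    intro m hm
    rw [coeff_derivative, monicOP_coeff_of_lt α t (by omega), zero_mul]
  have h3 : momentFunctional hα t (X * (X * derivative (monicOP α t n)) * monicOP α t (n + 1))
      = n * (recCoeff α (n + 1) t * normH α n t) := by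
    rw [momentFunctional_mul_monicOP hα t, coeff_X_mul, coeff_X_mul_derivative,
      monicOP_coeff_self, mul_one, normH_succ hα]
    rw [degree_lt_iff_coeff_zero]
    intro m hm
    obtain ⟨m, rfl⟩ : ∃ k, m = k + 1 := ⟨m - 1, by omega⟩
    rw [coeff_X_mul, coeff_X_mul_derivative, monicOP_coeff_of_lt α t (by omega), mul_zero]
  rw [hexp] at key
  simp only [map_add, map_sub, momentFunctional_C_mul, h1, h2, h3,
    momentFunctional_X_sq_mul_derivative, momentFunctional_X_mul_monicOP_succ_mul,
    momentFunctional_X_pow_three_mul] at key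
  refine mul_right_cancel₀ (normH_pos hα n t).ne' ?_
  rw [Nat.add_sub_cancel]
  push_cast
  linear_combination -key

/-- The quantity `R_n = 2n + 1 + 2α - 2t(β_n + β_{n+1})`. For `α > 0` it equals the
integral `auxR`, but this expression makes sense for every `α > -1`. -/
noncomputable def ladderR (α : ℝ) (n : ℕ) (t : ℝ) : ℝ :=
  2 * n + 1 + 2 * α - 2 * t * (recCoeff α n t + recCoeff α (n + 1) t)

/-- The second string equation, with `r_n = n - 2tβ_n`. It is a first integral of the
difference of two consecutive instances of the first one: that difference is
`r_{n+1} - r_n = β_{n+1} R_{n+1} - β_n R_{n-1}`, and multiplying by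
`R_n = r_{n+1} + r_n + 2α` makes both sides telescope. The factor `R_{n-1}` is written out
so that it has the right value at `n = 0`. -/
theorem ladder_quadratic {α : ℝ} (hα : -1 < α) (t : ℝ) (n : ℕ) :
    (n - 2 * t * recCoeff α n t) ^ 2 + 2 * α * (n - 2 * t * recCoeff α n t)
      = recCoeff α n t * ladderR α n t
        * (2 * n - 1 + 2 * α - 2 * t * (recCoeff α (n - 1) t + recCoeff α n t)) := by
  induction n with
  | zero => simp [recCoeff_zero]
  | succ n ih =>
    have h0 := recCoeffSum_eq hα t n
    have h1 := recCoeffSum_eq hα t (n + 1)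
    rw [recCoeffSum_succ] at h1
    simp only [ladderR, Nat.add_sub_cancel] at *
    push_cast at *
    linear_combination ih + (2 * n + 1 + 2 * α - 2 * t * (recCoeff α n t + recCoeff α (n + 1) t))
      * (h0 - h1)

/-! ### Hankel determinants and the Toda equations in `t` -/

theorem momentFunctional_X_pow {α : ℝ} (hα : -1 < α) (t : ℝ) (j : ℕ) :
    momentFunctional hα t (X ^ j) = jacobiMoment α t j := by
  rw [momentFunctional_apply]; simp [jacobiMoment]

/-- The change of basis from monomials to `P_0, …, P_{n-1}` is unitriangular and diagonalises the
Hankel matrix. -/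
theorem hankelD_eq_prod {α : ℝ} (hα : -1 < α) (n : ℕ) (t : ℝ) :
    hankelD α n t = ∏ j ∈ Finset.range n, normH α j t := by
  set A : Matrix (Fin n) (Fin n) ℝ := Matrix.of fun i j => (monicOP α t j).coeff i with hA
  set M : Matrix (Fin n) (Fin n) ℝ :=
    Matrix.of fun j k : Fin n => jacobiMoment α t ((j : ℕ) + (k : ℕ)) with hM
  have hdet : A.det = 1 :=
    Matrix.det_matrixOfPolynomials (fun j : Fin n => monicOP α t j)
      (fun j => (monicOP_degree α t j).2) (fun j => (monicOP_degree α t j).1)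
  have hsum : ∀ j : Fin n, monicOP α t j = ∑ i : Fin n, C (A i j) * X ^ (i : ℕ) := fun j => by
    conv_lhs => rw [(monicOP α t j).as_sum_range_C_mul_X_pow' (n := n)
      (by rw [(monicOP_degree α t j).2]; exact j.2)]
    rw [Finset.sum_range]
    rfl
  have hprod : A.transpose * M * A = Matrix.diagonal fun j : Fin n => normH α j t := by
    ext j k
    have h1 : momentFunctional hα t (monicOP α t j * monicOP α t k)
        = (A.transpose * M * A) j k := by
      rw [hsum j, hsum k, Finset.sum_mul_sum, Finset.sum_comm, map_sum, Matrix.mul_apply]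
      refine Finset.sum_congr rfl fun l _ => ?_
      rw [map_sum, Matrix.mul_apply, Finset.sum_mul]
      refine Finset.sum_congr rfl fun i _ => ?_
      have h2 : C (A i j) * X ^ (i : ℕ) * (C (A l k) * X ^ (l : ℕ))
          = C (A i j) * (C (A l k) * X ^ ((i : ℕ) + (l : ℕ))) := by ring
      rw [h2, momentFunctional_C_mul, momentFunctional_C_mul, momentFunctional_X_pow]
      simp only [hM, Matrix.transpose_apply, Matrix.of_apply]
      ring
    rw [← h1, momentFunctional_monicOP_mul, Matrix.diagonal_apply]
    by_cases h : j = k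
    · simp [h]
    · simp [h, Fin.val_ne_of_ne h]
  have h := congrArg Matrix.det hprod
  rw [Matrix.det_mul, Matrix.det_mul, Matrix.det_transpose, hdet, one_mul, mul_one,
    Matrix.det_diagonal] at h
  rw [Finset.prod_range]
  exact h

theorem hankelD_pos {α : ℝ} (hα : -1 < α) (n : ℕ) (t : ℝ) : 0 < hankelD α n t := by
  rw [hankelD_eq_prod hα]
  exact Finset.prod_pos fun j _ => normH_pos hα j t

theorem differentiable_hankelD {α : ℝ} (hα : -1 < α) (n : ℕ) : Differentiable ℝ (hankelD α n) := by
  have hmom : ∀ j, Differentiable ℝ fun s => jacobiMoment α s j := fun j s => by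
    simp only [← momentFunctional_X_pow hα]
    exact (hasDerivAt_momentFunctional hα s _).differentiableAt
  unfold hankelD
  simp only [Matrix.det_apply, Matrix.of_apply]
  refine Differentiable.fun_sum fun σ _ => Differentiable.const_smul ?_ _
  exact Differentiable.fun_finsetProd fun i _ => hmom _

theorem differentiable_normH {α : ℝ} (hα : -1 < α) (n : ℕ) : Differentiable ℝ (normH α n) := by
  have h : normH α n = fun t => hankelD α (n + 1) t / hankelD α n t := by
    funext t
    rw [eq_div_iff (hankelD_pos hα n t).ne', hankelD_eq_prod hα, hankelD_eq_prod hα,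
      Finset.prod_range_succ, mul_comm]
  rw [h]
  exact (differentiable_hankelD hα (n + 1)).fun_div (differentiable_hankelD hα n)
    fun t => (hankelD_pos hα n t).ne'

/-- The extremal property: among monic polynomials of degree `n`, `P_n` has the least norm. -/
theorem normH_le {α : ℝ} (hα : -1 < α) (t : ℝ) {q : ℝ[X]} (hq : q.Monic) :
    normH α q.natDegree t ≤ momentFunctional hα t (q * q) := by
  set P := monicOP α t q.natDegree
  have hlt : (q - P).degree < (q.natDegree : WithBot ℕ) := by
    rw [degree_lt_iff_coeff_zero]
    intro m hm
    rcases hm.eq_or_lt with rfl | h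
    · rw [coeff_sub, hq.coeff_natDegree, monicOP_coeff_self, sub_self]
    · rw [coeff_sub, coeff_eq_zero_of_natDegree_lt h, monicOP_coeff_of_lt α t h, sub_self]
  have h1 : momentFunctional hα t (P * (q - P)) = 0 :=
    momentFunctional_mul_eq_zero hα t
      (fun k hk => by rw [momentFunctional_monicOP_mul, if_neg hk.ne']) _ hlt
  have h2 : momentFunctional hα t (P * P) = normH α q.natDegree t := by
    rw [momentFunctional_monicOP_mul, if_pos rfl]
  have h3 : 0 ≤ momentFunctional hα t ((q - P) * (q - P)) := by
    rw [momentFunctional_mul]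
    by_cases h : q - P = 0
    · simp [h, jacobiInner]
    · exact (jacobiInner_self_pos hα t h).le
  have h4 : q * q = P * P + P * (q - P) + P * (q - P) + (q - P) * (q - P) := by ring
  rw [h4, map_add, map_add, map_add, h1, h2]
  linarith

/-- By the extremal property, `s ↦ ∫ P_n(x,t)² w(x,s) dx - h_n(s)` has a minimum at `s = t`, so
differentiating `h_n` does not involve the derivative of `P_n` in `t`. -/
theorem hasDerivAt_normH {α : ℝ} (hα : -1 < α) (n : ℕ) (t : ℝ) :
    HasDerivAt (normH α n) (-((recCoeff α n t + recCoeff α (n + 1) t) * normH α n t)) t := by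
  have h1 := (differentiable_normH hα n t).hasDerivAt
  have h2 := hasDerivAt_momentFunctional hα t (monicOP α t n * monicOP α t n)
  have hmin : IsLocalMin (fun s => momentFunctional hα s (monicOP α t n * monicOP α t n)
      - normH α n s) t := by
    refine Filter.Eventually.of_forall fun s => ?_
    have h := normH_le hα s (monicOP_degree α t n).1
    rw [(monicOP_degree α t n).2] at h
    simp only [momentFunctional_monicOP_mul, if_true, sub_self]
    linarith
  have h3 := hmin.hasDerivAt_eq_zero (h2.sub h1)
  have h4 : X ^ 2 * (monicOP α t n * monicOP α t n)
      = X * monicOP α t n * (X * monicOP α t n) := by ring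
  rw [h4, momentFunctional_X_mul_monicOP_mul_self] at h3
  refine h1.congr_deriv ?_
  linarith

/-- The Volterra (Langmuir) lattice. -/
theorem hasDerivAt_recCoeff {α : ℝ} (hα : -1 < α) (n : ℕ) (t : ℝ) :
    HasDerivAt (recCoeff α n)
      (recCoeff α n t * (recCoeff α (n - 1) t - recCoeff α (n + 1) t)) t := by
  rcases n with _ | n
  · refine (hasDerivAt_const t (0 : ℝ)).congr_deriv ?_
    rw [recCoeff_zero, zero_mul]
  · have hne := (normH_pos hα n t).ne'
    have h := (hasDerivAt_normH hα (n + 1) t).div (hasDerivAt_normH hα n t) hne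
    refine h.congr_deriv ?_
    rw [normH_succ hα, Nat.add_sub_cancel]
    field_simp
    ring

theorem hasDerivAt_recCoeffSum {α : ℝ} (hα : -1 < α) (n : ℕ) (t : ℝ) :
    HasDerivAt (recCoeffSum α n)
      (-(recCoeff α n t * (recCoeff α (n - 1) t + recCoeff α (n + 1) t))) t := by
  induction n with
  | zero =>
    have hf : recCoeffSum α 0 = fun _ => 0 := by funext s; simp [recCoeffSum]
    rw [hf]
    refine (hasDerivAt_const t (0 : ℝ)).congr_deriv ?_
    rw [recCoeff_zero, zero_mul, neg_zero]
  | succ n ih =>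
    have h := ih.add ((hasDerivAt_recCoeff hα n t).add (hasDerivAt_recCoeff hα (n + 1) t))
    have hf : recCoeffSum α (n + 1)
        = recCoeffSum α n + (recCoeff α n + recCoeff α (n + 1)) := by
      funext s; exact recCoeffSum_succ α n s
    rw [hf]
    refine h.congr_deriv ?_
    rw [Nat.add_sub_cancel]
    ring

theorem hasDerivAt_log_hankelD {α : ℝ} (hα : -1 < α) (n : ℕ) (t : ℝ) :
    HasDerivAt (fun s => Real.log (hankelD α n s)) (-recCoeffSum α n t) t := by
  have hf : (fun s => Real.log (hankelD α n s))
      = fun s => ∑ j ∈ Finset.range n, Real.log (normH α j s) := by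
    funext s
    rw [hankelD_eq_prod hα, Real.log_prod fun j _ => (normH_pos hα j s).ne']
  rw [hf]
  refine (HasDerivAt.fun_sum fun j _ =>
    (hasDerivAt_normH hα j t).log (normH_pos hα j t).ne').congr_deriv ?_
  rw [recCoeffSum, ← Finset.sum_neg_distrib]
  refine Finset.sum_congr rfl fun j _ => ?_
  have hne := (normH_pos hα j t).ne'
  field_simp

/-! ### The function `H_n` and its derivatives -/

theorem hankelH_eq {α : ℝ} (hα : -1 < α) (n : ℕ) (t : ℝ) :
    hankelH α n t = n * (n + 2 * α) - 2 * t * recCoeffSum α n t := by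
  rw [hankelH, (hasDerivAt_log_hankelD hα n t).deriv]
  ring

/-- The first string equation removes `β_{n±1}` from the derivative of `H_n`, so that `H_n''` still
involves only `β_{n-1}, β_n, β_{n+1}`. -/
theorem hasDerivAt_hankelH {α : ℝ} (hα : -1 < α) (n : ℕ) (t : ℝ) :
    HasDerivAt (hankelH α n) (-recCoeffSum α n t - n + 2 * (n + α + t) * recCoeff α n t
      - 2 * t * recCoeff α n t ^ 2) t := by
  have h := (((hasDerivAt_id' t).const_mul 2).fun_mul (hasDerivAt_recCoeffSum hα n t)).const_sub
    (n * (n + 2 * α) : ℝ)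
  have hf : hankelH α n = fun s => n * (n + 2 * α) - 2 * s * recCoeffSum α n s := by
    funext s; exact hankelH_eq hα n s
  rw [hf]
  refine h.congr_deriv ?_
  linear_combination -recCoeffSum_eq hα t n

theorem deriv_hankelH {α : ℝ} (hα : -1 < α) (n : ℕ) :
    deriv (hankelH α n) = fun t => -recCoeffSum α n t - n + 2 * (n + α + t) * recCoeff α n t
      - 2 * t * recCoeff α n t ^ 2 :=
  funext fun t => (hasDerivAt_hankelH hα n t).deriv

theorem hasDerivAt_deriv_hankelH {α : ℝ} (hα : -1 < α) (n : ℕ) (t : ℝ) :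
    HasDerivAt (deriv (hankelH α n))
      (recCoeff α n t * (recCoeff α (n - 1) t + recCoeff α (n + 1) t) + 2 * recCoeff α n t
        - 2 * recCoeff α n t ^ 2 + (2 * (n + α + t) - 4 * t * recCoeff α n t)
          * (recCoeff α n t * (recCoeff α (n - 1) t - recCoeff α (n + 1) t))) t := by
  have hS := hasDerivAt_recCoeffSum hα n t
  have hb := hasDerivAt_recCoeff hα n t
  have hid := hasDerivAt_id' t
  rw [deriv_hankelH hα]
  refine (((hS.fun_neg.sub_const (n : ℝ)).fun_add
    (((hid.const_add ((n : ℝ) + α)).const_mul 2).fun_mul hb)).fun_sub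
    ((hid.const_mul 2).fun_mul (hb.fun_pow 2))).congr_deriv ?_
  push_cast
  ring

/-! ### The integrals `R_j` for positive `α` -/

/-- Dividing by `1 - y²` lowers `α` by one, except possibly at the endpoints, where junk values
of division and of `0 ^ 0` may differ. -/
theorem auxRIntegrand_eqOn (α : ℝ) (n : ℕ) (t : ℝ) :
    Set.EqOn (auxRIntegrand α n t)
      (fun y => (monicOP α t n * monicOP α t n).eval y * jacobiWeight (α - 1) t y)
      (Set.Ioo (-1) 1) := by
  intro y hy
  have hpos : 0 < 1 - y ^ 2 := by nlinarith [hy.1, hy.2]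
  simp only [auxRIntegrand, jacobiWeight, Real.rpow_sub_one hpos.ne', eval_mul]
  ring

theorem intervalIntegrable_auxRIntegrand {α : ℝ} (hα : 0 < α) (n : ℕ) (t : ℝ) :
    IntervalIntegrable (auxRIntegrand α n t) MeasureTheory.volume (-1) 1 := by
  have h := jacobiInner_intervalIntegrable (show -1 < α - 1 by linarith) t
    (monicOP α t n) (monicOP α t n)
  rw [intervalIntegrable_iff_integrableOn_Ioo_of_le (by norm_num)] at h ⊢
  refine h.congr_fun (fun y hy => ?_) measurableSet_Ioo
  rw [auxRIntegrand_eqOn α n t hy]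
  simp only [eval_mul]

theorem integral_auxRIntegrand {α : ℝ} (hα : 0 < α) (n : ℕ) (t : ℝ) :
    ∫ y in (-1 : ℝ)..1, auxRIntegrand α n t y
      = momentFunctional (show -1 < α - 1 by linarith) t (monicOP α t n * monicOP α t n) := by
  rw [momentFunctional_apply, intervalIntegral.integral_of_le (by norm_num),
    intervalIntegral.integral_of_le (by norm_num), MeasureTheory.integral_Ioc_eq_integral_Ioo,
    MeasureTheory.integral_Ioc_eq_integral_Ioo]
  exact MeasureTheory.setIntegral_congr_fun measurableSet_Ioo (auxRIntegrand_eqOn α n t)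

theorem momentFunctional_sub_one {α : ℝ} (hα : 0 < α) (t : ℝ) (p : ℝ[X]) :
    momentFunctional (show -1 < α - 1 by linarith) t ((1 - X ^ 2) * p)
      = momentFunctional (show -1 < α by linarith) t p := by
  rw [momentFunctional_apply, momentFunctional_apply, intervalIntegral.integral_of_le (by norm_num),
    intervalIntegral.integral_of_le (by norm_num), MeasureTheory.integral_Ioc_eq_integral_Ioo,
    MeasureTheory.integral_Ioc_eq_integral_Ioo]
  refine MeasureTheory.setIntegral_congr_fun measurableSet_Ioo fun y hy => ?_
  have hpos : 0 < 1 - y ^ 2 := by nlinarith [hy.1, hy.2]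
  simp only [jacobiWeight, Real.rpow_sub_one hpos.ne', eval_mul, eval_sub, eval_one, eval_pow,
    eval_X]
  field_simp

/-- The Pearson identity with parameter `α - 1`, applied to `x P_n²`, evaluates the
integral defining `R_n`. -/
theorem auxR_eq_ladderR {α : ℝ} (hα : 0 < α) (n : ℕ) (t : ℝ) :
    auxR α n t = ladderR α n t := by
  have hα1 : -1 < α - 1 := by linarith
  have hα0 : -1 < α := by linarith
  set P := monicOP α t n with hP
  have key := momentFunctional_pearson hα1 t (X * (P * P))
  have hexp : (1 - X ^ 2) * derivative (X * (P * P)) - C (2 * (α - 1 + 1)) * (X * (X * (P * P)))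
        - C (2 * t) * (X * (1 - X ^ 2) * (X * (P * P)))
      = (1 - X ^ 2) * (P * P + C 2 * (X * derivative P * P) + C (2 * α) * (P * P)
          - C (2 * t) * (X * P * (X * P))) - C (2 * α) * (P * P) := by
    rw [derivative_mul, derivative_mul, derivative_X, sub_add_cancel]
    have : (C 2 : ℝ[X]) = 2 := rfl
    rw [this]
    ring
  rw [hexp, map_sub, momentFunctional_sub_one hα] at key
  simp only [map_add, map_sub, momentFunctional_C_mul, hP, momentFunctional_X_mul_derivative_mul,
    momentFunctional_X_mul_monicOP_mul_self] at key
  rw [← integral_auxRIntegrand hα, momentFunctional_monicOP_mul, if_pos rfl] at key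
  have hne := (normH_pos hα0 n t).ne'
  rw [auxR, ladderR, div_mul_eq_mul_div, div_eq_iff hne]
  linear_combination -key

theorem sum_ladderR {α : ℝ} (hα : -1 < α) (n : ℕ) (t : ℝ) :
    ∑ j ∈ Finset.range n, ladderR α j t = hankelH α n t := by
  rw [hankelH_eq hα]
  induction n with
  | zero => simp [recCoeffSum]
  | succ n ih =>
    rw [Finset.sum_range_succ, ih, recCoeffSum_succ, ladderR]
    push_cast
    ring

/-! ### Elimination -/

/-- The quantity `H - 2tH' + (t+α)²` is the square of `y = n + α + t - 2tβ`, and, with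
`{A}² = 16 [H - 2tH' + (t+α)²] {B}²` the equation to be proved, `A + 4yB` is
`16 t β y²` times the second string equation. Here `a`, `b`, `c` stand for `β_{n-1}`,
`β_n`, `β_{n+1}`. -/
theorem ode_of_string_equations (α t n a b c H H' H'' : ℝ)
    (hQ : (n - 2 * t * b) ^ 2 + 2 * α * (n - 2 * t * b)
      = b * (2 * n + 1 + 2 * α - 2 * t * (b + c)) * (2 * n - 1 + 2 * α - 2 * t * (a + b)))
    (hH : H = n * (n + 2 * α) - 2 * t * (n - 2 * (n + α + t) * b + 2 * t * b * (a + b + c)))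
    (hH' : H' = -(n - 2 * (n + α + t) * b + 2 * t * b * (a + b + c)) - n + 2 * (n + α + t) * b
      - 2 * t * b ^ 2)
    (hH'' : H'' = b * (a + c) + 2 * b - 2 * b ^ 2
      + (2 * (n + α + t) - 4 * t * b) * (b * (a - c))) :
    (4 * t ^ 3 * H'' ^ 2 + 4 * t ^ 2 * H'' * (H' - 2 * (t + α)) + 8 * t ^ 2 * H' ^ 3
          - t * H' ^ 2 * (4 * H + 4 * (t + α) ^ 2 - 32 * n * t - 1)
          - 4 * t * H' * (4 * (2 * n + α + t) * H
              + (3 * t + α) * (4 * n * t + 4 * n * α + 1))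
          + 8 * (n + α + t) * H ^ 2
          + 4 * H * (2 * t ^ 3 + 6 * t ^ 2 * (n + α) + t * (8 * n * α + 6 * α ^ 2 + 1)
              + 2 * α ^ 2 * (n + α))
          + 8 * t * (t + α) ^ 2 * (2 * n * (t + α) + 1)) ^ 2
        = 16 * (H - 2 * t * H' + (t + α) ^ 2)
          * (2 * t ^ 2 * H'' + t * (4 * H + 8 * n * t + 1) * H' - 2 * H ^ 2
              - 2 * H * (2 * n * t + (t + α) ^ 2)
              - 2 * t * (t + α) * (2 * n * (t + α) + 1)) ^ 2 := by
  set y := n + α + t - 2 * t * b with hy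
  have hsq : H - 2 * t * H' + (t + α) ^ 2 = y ^ 2 := by
    rw [hH, hH', hy]; ring
  have hA : 4 * t ^ 3 * H'' ^ 2 + 4 * t ^ 2 * H'' * (H' - 2 * (t + α)) + 8 * t ^ 2 * H' ^ 3
          - t * H' ^ 2 * (4 * H + 4 * (t + α) ^ 2 - 32 * n * t - 1)
          - 4 * t * H' * (4 * (2 * n + α + t) * H
              + (3 * t + α) * (4 * n * t + 4 * n * α + 1))
          + 8 * (n + α + t) * H ^ 2
          + 4 * H * (2 * t ^ 3 + 6 * t ^ 2 * (n + α) + t * (8 * n * α + 6 * α ^ 2 + 1)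
              + 2 * α ^ 2 * (n + α))
          + 8 * t * (t + α) ^ 2 * (2 * n * (t + α) + 1)
        = -(4 * y * (2 * t ^ 2 * H'' + t * (4 * H + 8 * n * t + 1) * H' - 2 * H ^ 2
              - 2 * H * (2 * n * t + (t + α) ^ 2)
              - 2 * t * (t + α) * (2 * n * (t + α) + 1))) := by
    rw [hH'', hH', hH, hy]
    linear_combination (16 * t * b * (n + α + t - 2 * t * b) ^ 2) * hQ
  rw [hA, hsq]
  ring

theorem mainTheorem5 (α : ℝ) (hα : -1 < α) (n : ℕ) :
    -- `D_n` is positive and differentiable, so that `ln D_n` and its derivative make sense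
    (∀ t : ℝ, 0 < hankelD α n t) ∧
    Differentiable ℝ (hankelD α n) ∧
    -- for `α > 0` the integrals defining the `R_j` converge, and `H_n` is the sum of the `R_j`
    (0 < α → ∀ t : ℝ,
      (∀ j < n, IntervalIntegrable (auxRIntegrand α j t) MeasureTheory.volume (-1) 1) ∧
      ∑ j ∈ Finset.range n, auxR α j t = hankelH α n t) ∧
    -- `H_n` is twice differentiable
    Differentiable ℝ (hankelH α n) ∧
    Differentiable ℝ (deriv (hankelH α n)) ∧
    -- the second-order differential equation
    (∀ t H H' H'' : ℝ,
      H = hankelH α n t → H' = deriv (hankelH α n) t → H'' = deriv (deriv (hankelH α n)) t →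
      (4 * t ^ 3 * H'' ^ 2 + 4 * t ^ 2 * H'' * (H' - 2 * (t + α)) + 8 * t ^ 2 * H' ^ 3
          - t * H' ^ 2 * (4 * H + 4 * (t + α) ^ 2 - 32 * n * t - 1)
          - 4 * t * H' * (4 * (2 * n + α + t) * H
              + (3 * t + α) * (4 * n * t + 4 * n * α + 1))
          + 8 * (n + α + t) * H ^ 2
          + 4 * H * (2 * t ^ 3 + 6 * t ^ 2 * (n + α) + t * (8 * n * α + 6 * α ^ 2 + 1)
              + 2 * α ^ 2 * (n + α))
          + 8 * t * (t + α) ^ 2 * (2 * n * (t + α) + 1)) ^ 2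
        = 16 * (H - 2 * t * H' + (t + α) ^ 2)
          * (2 * t ^ 2 * H'' + t * (4 * H + 8 * n * t + 1) * H' - 2 * H ^ 2
              - 2 * H * (2 * n * t + (t + α) ^ 2)
              - 2 * t * (t + α) * (2 * n * (t + α) + 1)) ^ 2) ∧
    -- the initial values
    hankelH α n 0 = n * (n + 2 * α) ∧
    ((2 * n - 1 + 2 * α) * (2 * n + 1 + 2 * α) ≠ 0 →
      deriv (hankelH α n) 0 =
        -(2 * n * (2 * n ^ 2 + 2 * n * α - 1)) / ((2 * n - 1 + 2 * α) * (2 * n + 1 + 2 * α))) ∧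
    -- the same value for `n = 1` after cancelling `1 + 2α`, which includes `α = -1/2`
    (n = 1 → deriv (hankelH α n) 0 = -2 / (3 + 2 * α)) := by
  refine ⟨hankelD_pos hα n, differentiable_hankelD hα n, fun hpos t =>
    ⟨fun j _ => intervalIntegrable_auxRIntegrand hpos j t, ?_⟩,
    fun t => (hasDerivAt_hankelH hα n t).differentiableAt,
    fun t => (hasDerivAt_deriv_hankelH hα n t).differentiableAt, ?_, ?_, ?_, ?_⟩
  · rw [← sum_ladderR hα]
    exact Finset.sum_congr rfl fun j _ => auxR_eq_ladderR hpos j t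
  · intro t H H' H'' hH hH' hH''
    rw [hankelH_eq hα, recCoeffSum_eq hα] at hH
    rw [(hasDerivAt_hankelH hα n t).deriv, recCoeffSum_eq hα] at hH'
    rw [(hasDerivAt_deriv_hankelH hα n t).deriv] at hH''
    exact ode_of_string_equations _ _ _ _ _ _ _ _ _ (ladder_quadratic hα t n) hH hH' hH''
  · rw [hankelH_eq hα]; ring
  · intro hne
    have hS := recCoeffSum_eq hα 0 n
    have hQ := ladder_quadratic hα 0 n
    rw [(hasDerivAt_hankelH hα n 0).deriv, eq_div_iff hne]
    simp only [ladderR] at hQ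
    linear_combination (-((2 * n - 1 + 2 * α) * (2 * n + 1 + 2 * α))) * hS - 4 * (n + α) * hQ
  · rintro rfl
    -- here `S_1 = β_1`, so the first string equation alone determines `β_1` at `t = 0`
    have hS := recCoeffSum_eq hα 0 1
    have hS1 : recCoeffSum α 1 0 = recCoeff α 1 0 := by simp [recCoeffSum, recCoeff_zero]
    rw [hS1] at hS
    have hne : 3 + 2 * α ≠ 0 := by linarith
    rw [(hasDerivAt_hankelH hα 1 0).deriv, eq_div_iff hne, hS1]
    push_cast at *
    linear_combination (1 + 2 * α) * hS
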